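/- Let $\Omega=\{x\in\mathbb R^3: x_3>0\}$, let $T>0$, and let $p>1$. Let $E_0,B_0\in W^{1,p}(\Omega;\mathbb R^3)$, and let $\rho:(0,T)\times\Omega\to\mathbb R$ and $J:(0,T)\times\Omega\to\mathbb R^3$ be locally integrable functions whose weak derivatives satisfy $$\nabla_x\rho,\ \nabla_xJ,\ \partial_tJ\in L^\infty\big((0,T);L^p_{\rm loc}(\Omega)\big),$$ and which satisfy the continuity equation $\nabla_x\cdot J=-\partial_t\rho$ in the sense of distributions on $(0,T)\times\Omega$. A pair $(E,B)$ of vector fields in $W^{1,\infty}((0,T)\times\Omega;\mathbb R^3)$ is called a solution if $$\partial_tE=\nabla_x\times B-4\pi J,\qquad \partial_tB=-\nabla_x\times E,\qquad \nabla_x\cdot E=4\pi\rho,\qquad \nabla_x\cdot B=0$$ hold almost everywhere in $(0,T)\times\Omega$ (with weak derivatives), and $$E(0,\cdot)=E_0,\quad B(0,\cdot)=B_0\ \text{ in }\Omega,\qquad E_1=E_2=0,\quad B_3=0\ \text{ on }(0,T)\times\partial\Omega$$ hold in the sense of traces, that is, for the continuous extensions of $E$ and $B$ to $[0,T]\times\overline\Omega$.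 Then there is at most one solution: if $(E,B)$ and $(\tilde E,\tilde B)$ are solutions with the same $E_0,B_0,\rho,J$, then $E=\tilde E$ and $B=\tilde B$ almost everywhere in $(0,T)\times\Omega$. -/

import Mathlib

open MeasureTheory Set
open scoped ENNReal NNReal ContDiff

/-- Three-dimensional Euclidean space. -/
abbrev R3 : Type := EuclideanSpace ℝ (Fin 3)

/-- Points `(t, x)` of space-time. -/
abbrev SpaceTime : Type := ℝ × R3

/-- The open half space `{x : x₃ > 0}`; the coordinates of `x` are `x 0, x 1, x 2`. -/
def halfSpace : Set R3 := {x | 0 < x 2}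

/-- The closed half space `{x : x₃ ≥ 0}`. -/
def closedHalfSpace : Set R3 := {x | 0 ≤ x 2}

/-- The space-time domain `(0, T) × Ω`. -/
def cyl (T : ℝ) : Set SpaceTime := Ioo 0 T ×ˢ halfSpace

/-- The direction of `∂_t`. -/
def timeDir : SpaceTime := (1, 0)

/-- The direction of `∂_{x_i}`. -/
noncomputable def spaceDir (i : Fin 3) : SpaceTime := (0, EuclideanSpace.single i 1)

/-- `g` is the weak (distributional) derivative of `f` in the direction `v` on the open set `U`. -/
def IsWeakDeriv {V F : Type*} [NormedAddCommGroup V] [NormedSpace ℝ V] [MeasureSpace V]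
    [NormedAddCommGroup F] [NormedSpace ℝ F] (U : Set V) (v : V) (f g : V → F) : Prop :=
  LocallyIntegrableOn f U volume ∧ LocallyIntegrableOn g U volume ∧
    ∀ φ : V → ℝ, ContDiff ℝ ∞ φ → HasCompactSupport φ → tsupport φ ⊆ U →
      ∫ z in U, (fderiv ℝ φ z v) • f z = - ∫ z in U, φ z • g z

/-- The Sobolev space `W^{1,p}(U)`. -/
def MemW1 {V F : Type*} [NormedAddCommGroup V] [NormedSpace ℝ V] [MeasureSpace V]
    [NormedAddCommGroup F] [NormedSpace ℝ F] (p : ℝ≥0∞) (U : Set V) (f : V → F) : Prop :=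
  MemLp f p (volume.restrict U) ∧
    ∀ v : V, ∃ g : V → F, MemLp g p (volume.restrict U) ∧ IsWeakDeriv U v f g

/-- `g ∈ L^∞((0,T); L^p_loc(Ω))`. -/
def MemLinftyLpLoc {F : Type*} [NormedAddCommGroup F] (T : ℝ) (p : ℝ≥0∞)
    (g : SpaceTime → F) : Prop :=
  AEStronglyMeasurable g (volume.restrict (cyl T)) ∧
    ∀ K : Set R3, IsCompact K → K ⊆ halfSpace →
      ∃ C : ℝ≥0, ∀ᵐ t ∂(volume.restrict (Ioo (0 : ℝ) T)),
        eLpNorm (fun x => g (t, x)) p (volume.restrict K) ≤ C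

/-- The divergence at `z` of a vector field whose partial derivatives `∂_{x_j}` are `D j`. -/
def divOf (D : Fin 3 → SpaceTime → R3) (z : SpaceTime) : ℝ := ∑ i, D i z i

/-- The curl at `z` of a vector field whose partial derivatives `∂_{x_j}` are `D j`. -/
def curlOf (D : Fin 3 → SpaceTime → R3) (z : SpaceTime) : R3 :=
  !₂[D 1 z 2 - D 2 z 1, D 2 z 0 - D 0 z 2, D 0 z 1 - D 1 z 0]

/-- `F'` is the continuous representative on `[0,T] × closure Ω` of the field `F` on
`(0,T) × Ω`; its values at `t = 0` and on `∂Ω` are the traces of `F`. It is unique, and it exists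
for every `F` in `W^{1,∞}((0,T) × Ω)`. -/
def IsContRep (T : ℝ) (F F' : SpaceTime → R3) : Prop :=
  ContinuousOn F' (Icc 0 T ×ˢ closedHalfSpace) ∧ F =ᵐ[volume.restrict (cyl T)] F'

/-- `(E, B)` is a `W^{1,∞}((0,T) × Ω)` solution of Maxwell's equations in the half space with
charge density `ρ`, current density `J`, initial data `(E₀, B₀)`, and the perfect conductor
boundary condition. -/
structure IsMaxwellSolution (T : ℝ) (ρ : SpaceTime → ℝ) (J : SpaceTime → R3) (E₀ B₀ : R3 → R3)
    (E B : SpaceTime → R3) : Prop where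
  memE : MemW1 ∞ (cyl T) E
  memB : MemW1 ∞ (cyl T) B
  /-- The equations hold almost everywhere; the derivatives are weak ones. -/
  maxwell : ∃ (dtE dtB : SpaceTime → R3) (dE dB : Fin 3 → SpaceTime → R3),
    IsWeakDeriv (cyl T) timeDir E dtE ∧ IsWeakDeriv (cyl T) timeDir B dtB ∧
    (∀ i, IsWeakDeriv (cyl T) (spaceDir i) E (dE i)) ∧
    (∀ i, IsWeakDeriv (cyl T) (spaceDir i) B (dB i)) ∧
    ∀ᵐ z ∂(volume.restrict (cyl T)),
      dtE z = curlOf dB z - (4 * Real.pi) • J z ∧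
      dtB z = - curlOf dE z ∧
      divOf dE z = 4 * Real.pi * ρ z ∧
      divOf dB z = 0
  /-- `E(0, ·) = E₀`, and `E₁ = E₂ = 0` on `∂Ω`, in the sense of traces. -/
  traceE : ∃ E' : SpaceTime → R3, IsContRep T E E' ∧
    (∀ᵐ x ∂(volume.restrict halfSpace), E' (0, x) = E₀ x) ∧
    ∀ t ∈ Ioo 0 T, ∀ x : R3, x 2 = 0 → E' (t, x) 0 = 0 ∧ E' (t, x) 1 = 0
  /-- `B(0, ·) = B₀`, and `B₃ = 0` on `∂Ω`, in the sense of traces. -/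
  traceB : ∃ B' : SpaceTime → R3, IsContRep T B B' ∧
    (∀ᵐ x ∂(volume.restrict halfSpace), B' (0, x) = B₀ x) ∧
    ∀ t ∈ Ioo 0 T, ∀ x : R3, x 2 = 0 → B' (t, x) 2 = 0

/-!
Maxwell's equations are linear, so the difference `u = (e, b)` of two solutions solves the
homogeneous equations, in which `ρ` and `J` no longer appear, with zero initial values and with
`e₁ = e₂ = 0` on `∂Ω`. The classical argument is the energy estimate
`∂ₜ (|e|² + |b|²) + 2 ∇ · (e × b) = 0` on a backward light cone: the flux of energy through `∂Ω` is
`2 (e × b)₃ = 2 (e₁ b₂ - e₂ b₁) = 0`, so the energy in a shrinking region stays zero. Fields in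
`W^{1,∞}` are bounded but need not be square integrable, so the estimate has to be local.

The evolution equations are written as a symmetric first order system `∂ₜu + ∑ⱼ Aⱼ ∂ⱼu = 0`. For a
weight `θ` with compact support in the open domain, `∫ ∑ₐ ∂ₐθ ⟪u, Aₐ u⟫ = 0`
(`integral_fderiv_mul_inner_eq_zero`). This holds for mollifications of `u`, which are classical
solutions near the support of `θ`; and as no derivative of `u` occurs in it, it passes to the limit
for bounded continuous `u`.

The weight is `θ = χ_δ(t) χ_δ(x₃) w(t, x)`. Here `w` (`coneWeight`) is smooth, supported in a
backward cone and in `t ≤ S < T`, and decreases so fast that `- ∂ₜw |u|² - ∑ⱼ ∂ⱼw ⟪u, Aⱼ u⟫` is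
bounded below by a positive multiple of `|u|²` inside the cone for `t < S` (`le_dissipation`). The
cutoffs `χ_δ` keep away from `t = 0` and `x₃ = 0`. Their derivatives have bounded integrals, while `|u|²` vanishes for `t = 0`
and the normal flux vanishes for `x₃ = 0`; by continuity up to the boundary, the terms in which a
cutoff is differentiated tend to zero (`tendsto_setIntegral_layer`). What remains is that the
integral of a nonnegative continuous function is zero, hence `u = 0`
(`eq_zero_of_maxwellSymbol_system`).
-/

/-! ### Weak derivatives -/

section WeakDerivatives

variable {V F G : Type*} [NormedAddCommGroup V] [NormedSpace ℝ V] [MeasureSpace V] [BorelSpace V]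
  [NormedAddCommGroup F] [NormedSpace ℝ F] [NormedAddCommGroup G] [NormedSpace ℝ G]
  {U : Set V} {v : V}

omit [NormedSpace ℝ V] in
/-- A locally integrable function on `U` times a continuous function with compact support in `U`
is integrable. -/
theorem MeasureTheory.LocallyIntegrableOn.integrableOn_smul_of_tsupport_subset {f : V → F}
    (hf : LocallyIntegrableOn f U volume) {φ : V → ℝ} (hφ : Continuous φ)
    (hc : HasCompactSupport φ) (hs : tsupport φ ⊆ U) :
    IntegrableOn (fun z => φ z • f z) U volume := by
  have h1 : IntegrableOn f (tsupport φ) volume := hf.integrableOn_compact_subset hs hc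
  have h2 : IntegrableOn (fun z => φ z • f z) (tsupport φ) volume :=
    h1.continuousOn_smul hφ.continuousOn hc
  rw [integrableOn_iff_integrable_of_support_subset] at h2
  · exact h2.integrableOn
  · intro z hz
    apply subset_tsupport
    intro h0
    exact hz (by simp [h0])

theorem IsWeakDeriv.integrableOn_fderiv_smul {f g : V → F} (h : IsWeakDeriv U v f g) {φ : V → ℝ}
    (hφ : ContDiff ℝ 1 φ) (hc : HasCompactSupport φ) (hs : tsupport φ ⊆ U) (w : V) :
    IntegrableOn (fun z => fderiv ℝ φ z w • f z) U volume :=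
  h.1.integrableOn_smul_of_tsupport_subset
    ((hφ.continuous_fderiv one_ne_zero).clm_apply continuous_const)
    (hc.fderiv_apply ℝ w) ((tsupport_fderiv_apply_subset ℝ w).trans hs)

theorem IsWeakDeriv.clm_comp [CompleteSpace F] [CompleteSpace G] {f g : V → F}
    (h : IsWeakDeriv U v f g) (L : F →L[ℝ] G) :
    IsWeakDeriv U v (fun z => L (f z)) (fun z => L (g z)) := by
  refine ⟨L.locallyIntegrableOn_comp h.1, L.locallyIntegrableOn_comp h.2.1, fun φ hφ hc hs => ?_⟩
  have h1 := h.integrableOn_fderiv_smul (hφ.of_le (by simp)) hc hs v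
  have h2 := h.2.1.integrableOn_smul_of_tsupport_subset hφ.continuous hc hs
  have := congrArg L (h.2.2 φ hφ hc hs)
  rw [map_neg, ← L.integral_comp_comm h1, ← L.integral_comp_comm h2] at this
  simpa only [map_smul] using this

theorem IsWeakDeriv.add {f₁ f₂ g₁ g₂ : V → F} (h₁ : IsWeakDeriv U v f₁ g₁)
    (h₂ : IsWeakDeriv U v f₂ g₂) :
    IsWeakDeriv U v (fun z => f₁ z + f₂ z) (fun z => g₁ z + g₂ z) := by
  refine ⟨h₁.1.add h₂.1, h₁.2.1.add h₂.2.1, fun φ hφ hc hs => ?_⟩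
  have e₁ := h₁.integrableOn_fderiv_smul (hφ.of_le (by simp)) hc hs v
  have e₂ := h₂.integrableOn_fderiv_smul (hφ.of_le (by simp)) hc hs v
  have i₁ := h₁.2.1.integrableOn_smul_of_tsupport_subset hφ.continuous hc hs
  have i₂ := h₂.2.1.integrableOn_smul_of_tsupport_subset hφ.continuous hc hs
  simp only [smul_add]
  rw [integral_add e₁ e₂, integral_add i₁ i₂, h₁.2.2 φ hφ hc hs, h₂.2.2 φ hφ hc hs, neg_add]

omit [BorelSpace V] in
theorem IsWeakDeriv.neg {f g : V → F} (h : IsWeakDeriv U v f g) :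
    IsWeakDeriv U v (fun z => - f z) (fun z => - g z) := by
  refine ⟨h.1.neg, h.2.1.neg, fun φ hφ hc hs => ?_⟩
  simp only [smul_neg, integral_neg, h.2.2 φ hφ hc hs]

theorem IsWeakDeriv.sub {f₁ f₂ g₁ g₂ : V → F} (h₁ : IsWeakDeriv U v f₁ g₁)
    (h₂ : IsWeakDeriv U v f₂ g₂) :
    IsWeakDeriv U v (fun z => f₁ z - f₂ z) (fun z => g₁ z - g₂ z) := by
  simpa only [sub_eq_add_neg] using h₁.add h₂.neg

omit [BorelSpace V] in
theorem IsWeakDeriv.congr_left {f f' g : V → F} (h : IsWeakDeriv U v f g)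
    (hf : f =ᵐ[volume.restrict U] f') : IsWeakDeriv U v f' g := by
  refine ⟨h.1.congr hf, h.2.1, fun φ hφ hc hs => ?_⟩
  rw [← h.2.2 φ hφ hc hs]
  refine integral_congr_ae ?_
  filter_upwards [hf] with z hz
  rw [hz]

/-- A first order system `∑ₐ Aₐ ∂ₐu = 0` that holds almost everywhere with weak derivatives holds
in the sense of distributions. -/
theorem integral_sum_fderiv_smul_eq_zero [CompleteSpace F] {κ : Type*} [Fintype κ] {d : κ → V}
    {A : κ → F →L[ℝ] F} {u : V → F} {du : κ → V → F} (hw : ∀ a, IsWeakDeriv U (d a) u (du a))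
    (hsum : ∀ᵐ z ∂(volume.restrict U), ∑ a, A a (du a z) = 0) {φ : V → ℝ}
    (hφ : ContDiff ℝ ∞ φ) (hc : HasCompactSupport φ) (hs : tsupport φ ⊆ U) :
    ∑ a, A a (∫ z in U, fderiv ℝ φ z (d a) • u z) = 0 := by
  have h2 : ∀ a, IntegrableOn (fun z => φ z • du a z) U volume := fun a =>
    (hw a).2.1.integrableOn_smul_of_tsupport_subset hφ.continuous hc hs
  have h3 : ∀ a, A a (∫ z in U, fderiv ℝ φ z (d a) • u z)
      = - ∫ z in U, A a (φ z • du a z) := fun a => by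
    rw [(hw a).2.2 φ hφ hc hs, map_neg, (A a).integral_comp_comm (h2 a)]
  simp only [h3, Finset.sum_neg_distrib]
  rw [← integral_finsetSum _ fun a _ => (A a).integrable_comp (h2 a), neg_eq_zero]
  refine integral_eq_zero_of_ae ?_
  filter_upwards [hsum] with z hz
  simp only [map_smul, ← Finset.smul_sum, hz, smul_zero, Pi.zero_apply]

end WeakDerivatives

/-! ### The energy identity for symmetric first order systems -/

section EnergyIdentity

open scoped Convolution Topology
open Filter ContinuousLinearMap

variable {V H κ : Type*} [NormedAddCommGroup V] [NormedSpace ℝ V] [MeasureSpace V] [BorelSpace V]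
  [FiniteDimensional ℝ V] [(volume : Measure V).IsAddHaarMeasure]
  [NormedAddCommGroup H] [InnerProductSpace ℝ H] [CompleteSpace H] [Fintype κ]
  {U : Set V}

omit [CompleteSpace H] in
/-- The directional derivatives of a mollification, in terms of the test function
`y ↦ η (z - y)`. -/
theorem fderiv_normed_convolution_indicator (hU : MeasurableSet U) {u : V → H}
    (hu : LocallyIntegrable (U.indicator u) volume) (η : ContDiffBump (0 : V)) (z v : V) :
    fderiv ℝ (η.normed volume ⋆[lsmul ℝ ℝ, volume] U.indicator u) z v
      = - ∫ y in U, fderiv ℝ (fun y => η.normed volume (z - y)) y v • u y := by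
  have hη : ContDiff ℝ 1 (η.normed (volume : Measure V)) := η.contDiff_normed
  have hηc : HasCompactSupport (η.normed (volume : Measure V)) := η.hasCompactSupport_normed
  have hd := hηc.hasFDerivAt_convolution_left (lsmul ℝ ℝ) hη hu z
  have hex : ConvolutionExistsAt (fderiv ℝ (η.normed (volume : Measure V))) (U.indicator u) z
      ((lsmul ℝ ℝ : ℝ →L[ℝ] H →L[ℝ] H).precompL V) volume :=
    (hηc.fderiv ℝ).convolutionExists_left _ (hη.continuous_fderiv one_ne_zero) hu z
  have hv : ∀ y, fderiv ℝ (fun y => η.normed (volume : Measure V) (z - y)) y v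
      = - fderiv ℝ (η.normed (volume : Measure V)) (z - y) v := fun y => by
    have h1 : HasFDerivAt (fun y : V => z - y) (-(ContinuousLinearMap.id ℝ V)) y :=
      (hasFDerivAt_id y).const_sub z
    have h2 := ((hη.differentiable one_ne_zero) (z - y)).hasFDerivAt.comp y h1
    rw [show (fun y => η.normed (volume : Measure V) (z - y))
      = η.normed volume ∘ fun y => z - y from rfl, h2.fderiv]
    simp
  rw [hd.fderiv, convolution_def, ContinuousLinearMap.integral_apply hex]
  simp only [hv, neg_smul, integral_neg, neg_neg]
  rw [← integral_sub_left_eq_self _ volume z, ← integral_indicator hU]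
  congr 1
  ext y
  by_cases hy : y ∈ U <;> simp [hy, precompL_apply]

/-- The mollification of a weak solution of `∑ₐ Aₐ ∂ₐu = 0` is a classical solution, away from the
boundary. -/
theorem sum_fderiv_normed_convolution_eq_zero (hU : MeasurableSet U) {d : κ → V}
    {A : κ → H →L[ℝ] H} {u : V → H} {du : κ → V → H} (hw : ∀ a, IsWeakDeriv U (d a) u (du a))
    (hsum : ∀ᵐ z ∂(volume.restrict U), ∑ a, A a (du a z) = 0)
    (hu : LocallyIntegrable (U.indicator u) volume) (η : ContDiffBump (0 : V)) {z : V}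
    (hz : Metric.closedBall z η.rOut ⊆ U) :
    ∑ a, A a (fderiv ℝ (η.normed volume ⋆[lsmul ℝ ℝ, volume] U.indicator u) z (d a)) = 0 := by
  simp only [fderiv_normed_convolution_indicator hU hu, map_neg, Finset.sum_neg_distrib]
  rw [neg_eq_zero]
  have hcont : ContDiff ℝ ∞ (η.normed (volume : Measure V)) := η.contDiff_normed
  have hsub : tsupport (fun y => η.normed (volume : Measure V) (z - y))
      ⊆ Metric.closedBall z η.rOut := by
    refine closure_minimal (fun y hy => ?_) Metric.isClosed_closedBall
    have h1 : z - y ∈ Function.support (η.normed (volume : Measure V)) := hy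
    rw [η.support_normed_eq] at h1
    rw [Metric.mem_closedBall, dist_comm, dist_eq_norm]
    exact (mem_ball_zero_iff.1 h1).le
  exact integral_sum_fderiv_smul_eq_zero hw hsum (hcont.comp (contDiff_const.sub contDiff_id))
    (HasCompactSupport.of_support_subset_isCompact (isCompact_closedBall z η.rOut)
      ((subset_tsupport _).trans hsub)) (hsub.trans hz)

omit [CompleteSpace H] in
/-- The energy identity for a `C¹` function that solves the symmetric system `∑ₐ Aₐ ∂ₐu = 0` on
the support of the weight `θ`. -/
theorem integral_fderiv_mul_inner_eq_zero_of_contDiff {d : κ → V} {A : κ → H →L[ℝ] H}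
    (hA : ∀ a x y, inner ℝ (A a x) y = inner ℝ x (A a y)) {u : V → H} (hu : ContDiff ℝ 1 u)
    {θ : V → ℝ} (hθ : ContDiff ℝ 1 θ) (hc : HasCompactSupport θ)
    (hsum : ∀ z ∈ tsupport θ, ∑ a, A a (fderiv ℝ u z (d a)) = 0) :
    ∫ z, ∑ a, fderiv ℝ θ z (d a) * inner ℝ (u z) (A a (u z)) = 0 := by
  have hAu : ∀ a, ContDiff ℝ 1 fun z => A a (u z) := fun a => (A a).contDiff.comp hu
  have hq : ∀ a, ContDiff ℝ 1 fun z => inner ℝ (u z) (A a (u z)) := fun a => hu.inner ℝ (hAu a)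
  have hqd : ∀ a z, fderiv ℝ (fun z => inner ℝ (u z) (A a (u z))) z (d a)
      = 2 * inner ℝ (u z) (A a (fderiv ℝ u z (d a))) := fun a z => by
    have h1 := (hu.differentiable one_ne_zero z)
    have h2 := (A a).hasFDerivAt.comp z h1.hasFDerivAt
    have h3 : fderiv ℝ (fun z => A a (u z)) z = (A a).comp (fderiv ℝ u z) := h2.fderiv
    rw [fderiv_inner_apply ℝ h1 ((hAu a).differentiable one_ne_zero z), h3]
    have h4 : inner ℝ (fderiv ℝ u z (d a)) (A a (u z))
        = inner ℝ (u z) (A a (fderiv ℝ u z (d a))) := by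
      rw [← hA a, real_inner_comm]
    rw [h4, two_mul, comp_apply]
  have hd : ∀ a, Continuous fun z => fderiv ℝ θ z (d a) := fun a =>
    (hθ.continuous_fderiv one_ne_zero).clm_apply continuous_const
  have i1 : ∀ a, Integrable fun z => fderiv ℝ θ z (d a) * inner ℝ (u z) (A a (u z)) := fun a =>
    ((hd a).mul (hq a).continuous).integrable_of_hasCompactSupport
      ((hc.fderiv_apply ℝ (d a)).mul_right)
  have i2 : ∀ a, Integrable fun z =>
      θ z * fderiv ℝ (fun z => inner ℝ (u z) (A a (u z))) z (d a) := fun a =>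
    (hθ.continuous.mul (((hq a).continuous_fderiv one_ne_zero).clm_apply
      continuous_const)).integrable_of_hasCompactSupport hc.mul_right
  have i3 : ∀ a, Integrable fun z => θ z * inner ℝ (u z) (A a (u z)) := fun a =>
    (hθ.continuous.mul (hq a).continuous).integrable_of_hasCompactSupport hc.mul_right
  have hparts : ∀ a, ∫ z, fderiv ℝ θ z (d a) * inner ℝ (u z) (A a (u z))
      = - ∫ z, θ z * fderiv ℝ (fun z => inner ℝ (u z) (A a (u z))) z (d a) := fun a => by
    rw [integral_mul_fderiv_eq_neg_fderiv_mul_of_integrable (i1 a) (i2 a) (i3 a)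
      (fun z _ => hθ.differentiable one_ne_zero z)
      (fun z _ => (hq a).differentiable one_ne_zero z), neg_neg]
  rw [integral_finsetSum _ fun a _ => i1 a]
  simp only [hparts, Finset.sum_neg_distrib]
  rw [← integral_finsetSum _ fun a _ => i2 a, neg_eq_zero]
  refine integral_eq_zero_of_ae (Eventually.of_forall fun z => ?_)
  by_cases hz : z ∈ tsupport θ
  · simp only [hqd, Pi.zero_apply, ← Finset.mul_sum, ← inner_sum, hsum z hz, inner_zero_right,
      mul_zero]
  · simp [image_eq_zero_of_notMem_tsupport hz]

/-- The energy identity for a bounded continuous weak solution of a symmetric first order system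
`∑ₐ Aₐ ∂ₐu = 0`, tested against a weight with compact support in the domain. It holds for the
mollifications of `u`, and it involves no derivatives of `u`, so it passes to the limit. -/
theorem integral_fderiv_mul_inner_eq_zero (hU : IsOpen U) {d : κ → V} {A : κ → H →L[ℝ] H}
    (hA : ∀ a x y, inner ℝ (A a x) y = inner ℝ x (A a y)) {u : V → H} {du : κ → V → H}
    (hw : ∀ a, IsWeakDeriv U (d a) u (du a))
    (hsum : ∀ᵐ z ∂(volume.restrict U), ∑ a, A a (du a z) = 0) (hcont : ContinuousOn u U)
    {M : ℝ} (hM : ∀ z ∈ U, ‖u z‖ ≤ M) {θ : V → ℝ} (hθ : ContDiff ℝ 1 θ)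
    (hc : HasCompactSupport θ) (hs : tsupport θ ⊆ U) :
    ∫ z in U, ∑ a, fderiv ℝ θ z (d a) * inner ℝ (u z) (A a (u z)) = 0 := by
  -- The extension by zero is bounded and measurable, so its mollifications are smooth and obey the
  -- same bound.
  set u₁ := U.indicator u with hu₁
  have hmeas : AEStronglyMeasurable u₁ volume := by
    rw [hu₁, aestronglyMeasurable_indicator_iff hU.measurableSet]
    exact hcont.aestronglyMeasurable hU.measurableSet
  have hbd : ∀ z, ‖u₁ z‖ ≤ |M| := fun z => by
    by_cases hz : z ∈ U
    · simpa [hu₁, hz] using (hM z hz).trans (le_abs_self M)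
    · simp [hu₁, hz]
  have hloc : LocallyIntegrable u₁ volume :=
    (memLp_top_of_bound hmeas |M| (Eventually.of_forall hbd)).locallyIntegrable le_top
  let η : ℕ → ContDiffBump (0 : V) := fun n =>
    ⟨1 / ((n : ℝ) + 1) / 2, 1 / ((n : ℝ) + 1), by positivity, half_lt_self (by positivity)⟩
  have hη : Tendsto (fun n => (η n).rOut) atTop (𝓝 0) := tendsto_one_div_add_atTop_nhds_zero_nat
  let w : ℕ → V → H := fun n => (η n).normed volume ⋆[lsmul ℝ ℝ, volume] u₁
  have hwC : ∀ n, ContDiff ℝ 1 (w n) := fun n =>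
    (η n).hasCompactSupport_normed.contDiff_convolution_left _ (η n).contDiff_normed hloc
  have hwbd : ∀ n z, ‖w n z‖ ≤ |M| := fun n z => by
    have := dist_convolution_le (μ := volume) (x₀ := z) (z₀ := (0 : H)) (abs_nonneg M)
      (η n).support_normed_eq.subset (η n).nonneg_normed (η n).integral_normed hmeas
      (fun y _ => by simpa using hbd y)
    simpa using this
  have hwlim : ∀ z ∈ U, Tendsto (fun n => w n z) atTop (𝓝 (u z)) := fun z hz => by
    have h1 : ContinuousAt u₁ z :=
      ((hcont z hz).continuousAt (hU.mem_nhds hz)).congr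
        (eventually_of_mem (hU.mem_nhds hz) fun y hy => (indicator_of_mem hy u).symm)
    have h2 : u₁ z = u z := indicator_of_mem hz u
    rw [← h2]
    exact ContDiffBump.convolution_tendsto_right hη (Eventually.of_forall fun _ => hmeas)
      (h1.tendsto.comp tendsto_snd) tendsto_const_nhds
  -- Once the mollification radius is below the distance from `tsupport θ` to the complement of `U`,
  -- the mollified field is a classical solution on `tsupport θ`.
  obtain ⟨δ, hδ, hδU⟩ := hc.isCompact.exists_cthickening_subset_open hU hs
  have hzero : ∀ᶠ n in atTop,
      ∫ z in U, ∑ a, fderiv ℝ θ z (d a) * inner ℝ (w n z) (A a (w n z)) = 0 := by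
    filter_upwards [hη.eventually_le_const hδ] with n hn
    rw [setIntegral_eq_integral_of_forall_compl_eq_zero]
    · refine integral_fderiv_mul_inner_eq_zero_of_contDiff hA (hwC n) hθ hc fun z hz => ?_
      refine sum_fderiv_normed_convolution_eq_zero hU.measurableSet hw hsum hloc (η n) ?_
      exact ((Metric.closedBall_subset_closedBall hn).trans
        (Metric.closedBall_subset_cthickening hz δ)).trans hδU
    · intro z hz
      have : z ∉ tsupport (fderiv ℝ θ) := fun h => hz (hs (tsupport_fderiv_subset ℝ h))
      simp [image_eq_zero_of_notMem_tsupport this]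
  have hlim : Tendsto
      (fun n => ∫ z in U, ∑ a, fderiv ℝ θ z (d a) * inner ℝ (w n z) (A a (w n z))) atTop
      (𝓝 (∫ z in U, ∑ a, fderiv ℝ θ z (d a) * inner ℝ (u z) (A a (u z)))) := by
    have hd : ∀ a, Continuous fun z => fderiv ℝ θ z (d a) := fun a =>
      (hθ.continuous_fderiv one_ne_zero).clm_apply continuous_const
    refine tendsto_integral_of_dominated_convergence
      (fun z => ∑ a, ‖fderiv ℝ θ z (d a)‖ * (|M| * (‖A a‖ * |M|))) (fun n => ?_) ?_
      (fun n => Eventually.of_forall fun z => ?_) ?_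
    · exact Continuous.aestronglyMeasurable <| continuous_finsetSum _ fun a _ =>
        (hd a).mul ((hwC n).continuous.inner ((A a).continuous.comp (hwC n).continuous))
    · refine (integrable_finsetSum _ fun a _ => Integrable.mul_const ?_ _).integrableOn
      exact ((hd a).integrable_of_hasCompactSupport (hc.fderiv_apply ℝ (d a))).norm
    · refine (norm_sum_le _ _).trans (Finset.sum_le_sum fun a _ => ?_)
      rw [norm_mul]
      gcongr
      refine (norm_inner_le_norm _ _).trans ?_
      gcongr
      · exact hwbd n z
      · refine ((A a).le_opNorm _).trans ?_
        gcongr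
        exact hwbd n z
    · filter_upwards [ae_restrict_mem hU.measurableSet] with z hz
      refine tendsto_finsetSum _ fun a _ => ((hwlim z hz).inner ?_).const_mul _
      exact ((A a).continuous.tendsto _).comp (hwlim z hz)
  exact tendsto_nhds_unique hlim (tendsto_const_nhds.congr' (hzero.mono fun n hn => hn.symm))

end EnergyIdentity

/-! ### Boundary layers -/

section BoundaryLayer

open Filter
open scoped Topology

/-- A smooth cutoff that vanishes for `r ≤ δ` and is `1` for `2δ ≤ r`. -/
noncomputable def layerCutoff (δ r : ℝ) : ℝ := Real.smoothTransition (r / δ - 1)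

namespace layerCutoff

variable {δ r : ℝ}

theorem contDiff (δ : ℝ) : ContDiff ℝ ∞ (layerCutoff δ) :=
  Real.smoothTransition.contDiff.comp ((contDiff_id.div_const δ).sub contDiff_const)

theorem hasDerivAt (δ r : ℝ) : HasDerivAt (layerCutoff δ) (deriv (layerCutoff δ) r) r :=
  ((contDiff δ).differentiable (by simp) r).hasDerivAt

theorem continuous_deriv (δ : ℝ) : Continuous (deriv (layerCutoff δ)) :=
  (contDiff δ).continuous_deriv (by simp)

theorem nonneg (δ r : ℝ) : 0 ≤ layerCutoff δ r := Real.smoothTransition.nonneg _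

theorem le_one (δ r : ℝ) : layerCutoff δ r ≤ 1 := Real.smoothTransition.le_one _

theorem abs_le_one (δ r : ℝ) : |layerCutoff δ r| ≤ 1 := by
  rw [abs_of_nonneg (nonneg δ r)]
  exact le_one δ r

theorem lt_of_ne_zero (hδ : 0 < δ) (h : layerCutoff δ r ≠ 0) : δ < r := by
  by_contra! hr
  refine h (Real.smoothTransition.zero_of_nonpos ?_)
  rw [sub_nonpos, div_le_one hδ]
  exact hr

theorem eq_one (hδ : 0 < δ) (h : 2 * δ ≤ r) : layerCutoff δ r = 1 := by
  refine Real.smoothTransition.one_of_one_le ?_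
  rw [le_sub_iff_add_le, le_div_iff₀ hδ]
  linarith

theorem deriv_nonneg (hδ : 0 < δ) (r : ℝ) : 0 ≤ deriv (layerCutoff δ) r := by
  refine Monotone.deriv_nonneg fun a b hab => ?_
  refine Real.smoothTransition.monotone ?_
  gcongr

theorem deriv_eq_zero (hδ : 0 < δ) (h : 2 * δ < r) : deriv (layerCutoff δ) r = 0 := by
  have : layerCutoff δ =ᶠ[𝓝 r] fun _ => 1 :=
    (eventually_gt_nhds h).mono fun s hs => eq_one hδ hs.le
  rw [this.deriv_eq, deriv_const]

theorem tendsto_one (hr : 0 < r) : Tendsto (fun δ => layerCutoff δ r) (𝓝[>] 0) (𝓝 1) := by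
  refine tendsto_const_nhds.congr' ?_
  filter_upwards [self_mem_nhdsWithin,
    mem_nhdsWithin_of_mem_nhds (Iio_mem_nhds (half_pos hr))] with δ hδ hδr
  rw [eq_one hδ]
  have : δ < r / 2 := hδr
  linarith

end layerCutoff

variable {V : Type*} [NormedAddCommGroup V] [NormedSpace ℝ V] [MeasureSpace V] [BorelSpace V]
  [FiniteDimensional ℝ V] [(volume : Measure V).IsAddHaarMeasure]

/-- The cutoff has a derivative of order `1/δ` in a layer of width `δ`; its integral stays bounded.
Against a fixed bump function, the derivative can be moved to the bump function. -/
theorem exists_setIntegral_deriv_layerCutoff_le {K : Set V} (hK : IsCompact K) (l : V →L[ℝ] ℝ)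
    {d : V} (hd : l d = 1) :
    ∃ M : ℝ, 0 ≤ M ∧ ∀ δ > 0, ∫ z in K, deriv (layerCutoff δ) (l z) ≤ M := by
  obtain ⟨R, hR⟩ := hK.isBounded.subset_closedBall (0 : V)
  let b : ContDiffBump (0 : V) := ⟨|R| + 1, |R| + 2, by positivity, by linarith⟩
  have hbK : ∀ z ∈ K, b z = 1 := fun z hz => by
    refine b.one_of_mem_closedBall (Metric.closedBall_subset_closedBall ?_ (hR hz))
    linarith [le_abs_self R]
  have hbC : ContDiff ℝ 1 (b : V → ℝ) := b.contDiff
  have hbc : HasCompactSupport (b : V → ℝ) := b.hasCompactSupport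
  have hdb : Continuous fun z => fderiv ℝ b z d :=
    (hbC.continuous_fderiv one_ne_zero).clm_apply continuous_const
  refine ⟨∫ z, ‖fderiv ℝ b z d‖, integral_nonneg fun z => norm_nonneg _, fun δ hδ => ?_⟩
  have hsC : ContDiff ℝ ∞ fun z => layerCutoff δ (l z) :=
    (layerCutoff.contDiff δ).comp l.contDiff
  have hsd : ∀ z, fderiv ℝ (fun z => layerCutoff δ (l z)) z d = deriv (layerCutoff δ) (l z) :=
    fun z => by
      have := (layerCutoff.hasDerivAt δ (l z)).comp_hasFDerivAt z l.hasFDerivAt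
      rw [show (fun z => layerCutoff δ (l z)) = layerCutoff δ ∘ l from rfl, this.fderiv]
      simp [hd]
  have hcd : Continuous fun z => deriv (layerCutoff δ) (l z) :=
    (layerCutoff.continuous_deriv δ).comp l.continuous
  have i1 : Integrable fun z => b z * deriv (layerCutoff δ) (l z) :=
    (hbC.continuous.mul hcd).integrable_of_hasCompactSupport hbc.mul_right
  have i2 : Integrable fun z => fderiv ℝ b z d * layerCutoff δ (l z) :=
    (hdb.mul hsC.continuous).integrable_of_hasCompactSupport (hbc.fderiv_apply ℝ d).mul_right
  have i3 : Integrable fun z => b z * layerCutoff δ (l z) :=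
    (hbC.continuous.mul hsC.continuous).integrable_of_hasCompactSupport hbc.mul_right
  have i4 : Integrable fun z => ‖fderiv ℝ b z d‖ :=
    (hdb.integrable_of_hasCompactSupport (hbc.fderiv_apply ℝ d)).norm
  calc ∫ z in K, deriv (layerCutoff δ) (l z)
      = ∫ z in K, b z * deriv (layerCutoff δ) (l z) :=
        setIntegral_congr_fun hK.measurableSet fun z hz => by simp [hbK z hz]
    _ ≤ ∫ z, b z * deriv (layerCutoff δ) (l z) :=
        setIntegral_le_integral i1 (Eventually.of_forall fun z =>
          mul_nonneg b.nonneg (layerCutoff.deriv_nonneg hδ _))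
    _ = - ∫ z, fderiv ℝ b z d * layerCutoff δ (l z) := by
        rw [← integral_mul_fderiv_eq_neg_fderiv_mul_of_integrable i2 (by simpa only [hsd] using i1)
          i3 (fun z _ => hbC.differentiable one_ne_zero z)
          (fun z _ => hsC.differentiable (by simp) z)]
        simp only [hsd]
    _ ≤ ∫ z, ‖fderiv ℝ b z d‖ := by
        rw [← integral_neg]
        refine integral_mono i2.neg i4 fun z => (le_abs_self _).trans ?_
        simp only [abs_neg, abs_mul, Real.norm_eq_abs]
        exact mul_le_of_le_one_right (abs_nonneg _) (layerCutoff.abs_le_one _ _)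

/-- A continuous function on a compact set that vanishes where `l = 0` is uniformly small where
`l` is small. -/
theorem IsCompact.exists_forall_le_imp_abs_lt {X : Type*} [TopologicalSpace X] [T2Space X] {K : Set X}
    (hK : IsCompact K) {l G : X → ℝ} (hl : ContinuousOn l K) (hG : ContinuousOn G K)
    (hpos : ∀ z ∈ K, 0 ≤ l z) (hzero : ∀ z ∈ K, l z = 0 → G z = 0) {ε : ℝ} (hε : 0 < ε) :
    ∃ r > 0, ∀ z ∈ K, l z ≤ r → |G z| < ε := by
  have hC : IsCompact (K ∩ (fun z => |G z|) ⁻¹' Ici ε) :=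
    hK.of_isClosed_subset (hG.abs.preimage_isClosed_of_isClosed hK.isClosed isClosed_Ici)
      inter_subset_left
  rcases (K ∩ (fun z => |G z|) ⁻¹' Ici ε).eq_empty_or_nonempty with h | h
  · refine ⟨1, one_pos, fun z hz _ => ?_⟩
    by_contra! hlt
    exact (h ▸ (⟨hz, hlt⟩ : z ∈ K ∩ (fun z => |G z|) ⁻¹' Ici ε) : z ∈ (∅ : Set X))
  · obtain ⟨z₀, hz₀, hmin⟩ := hC.exists_isMinOn h (hl.mono inter_subset_left)
    have hl0 : 0 < l z₀ := by
      refine lt_of_le_of_ne (hpos z₀ hz₀.1) fun h0 => ?_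
      have h1 : ε ≤ |G z₀| := hz₀.2
      rw [hzero z₀ hz₀.1 h0.symm, abs_zero] at h1
      linarith
    refine ⟨l z₀ / 2, half_pos hl0, fun z hz hlz => ?_⟩
    by_contra! hlt
    have : l z₀ ≤ l z := hmin ⟨hz, hlt⟩
    linarith

/-- The boundary term on `l = 0` vanishes in the limit: the integrands `F δ` live in the layer
where the cutoff varies, and are controlled by a continuous function that vanishes for `l = 0`. -/
theorem tendsto_setIntegral_layer {S K : Set V} (hS : MeasurableSet S) (hK : IsCompact K)
    (l : V →L[ℝ] ℝ) {d : V} (hd : l d = 1) {G : V → ℝ} (hG : ContinuousOn G K)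
    (hpos : ∀ z ∈ K, 0 ≤ l z) (hzero : ∀ z ∈ K, l z = 0 → G z = 0) {F : ℝ → V → ℝ}
    (hF : ∀ δ > 0, ∀ z ∈ S, z ∈ K → |F δ z| ≤ deriv (layerCutoff δ) (l z) * |G z|)
    (hFK : ∀ δ > 0, ∀ z ∈ S, z ∉ K → F δ z = 0) :
    Tendsto (fun δ => ∫ z in S, F δ z) (𝓝[>] 0) (𝓝 0) := by
  obtain ⟨M, hM0, hM⟩ := exists_setIntegral_deriv_layerCutoff_le hK l hd
  rw [Metric.tendsto_nhds]
  intro ε hε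
  obtain ⟨r, hr, hGr⟩ := hK.exists_forall_le_imp_abs_lt l.continuous.continuousOn hG hpos hzero
    (ε := ε / (M + 1)) (by positivity)
  filter_upwards [self_mem_nhdsWithin,
    mem_nhdsWithin_of_mem_nhds (Iio_mem_nhds (half_pos hr))] with δ hδ hδr
  have hδ : 0 < δ := hδ
  have hδr : δ < r / 2 := hδr
  have hcd : Continuous fun z => deriv (layerCutoff δ) (l z) * (ε / (M + 1)) :=
    ((layerCutoff.continuous_deriv δ).comp l.continuous).mul continuous_const
  have hi : Integrable (K.indicator fun z => deriv (layerCutoff δ) (l z) * (ε / (M + 1))) :=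
    (hcd.continuousOn.integrableOn_compact hK).integrable_indicator hK.measurableSet
  have hnn : ∀ z, 0 ≤ deriv (layerCutoff δ) (l z) * (ε / (M + 1)) := fun z =>
    mul_nonneg (layerCutoff.deriv_nonneg hδ _) (by positivity)
  rw [dist_zero_right]
  calc ‖∫ z in S, F δ z‖
      ≤ ∫ z in S, K.indicator (fun z => deriv (layerCutoff δ) (l z) * (ε / (M + 1))) z := by
        refine norm_integral_le_of_norm_le hi.integrableOn ?_
        filter_upwards [ae_restrict_mem hS] with z hz
        by_cases hzK : z ∈ K
        · rw [indicator_of_mem hzK, Real.norm_eq_abs]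
          refine (hF δ hδ z hz hzK).trans ?_
          rcases le_or_gt (l z) (2 * δ) with h | h
          · exact mul_le_mul_of_nonneg_left (hGr z hzK (by linarith)).le
              (layerCutoff.deriv_nonneg hδ _)
          · rw [layerCutoff.deriv_eq_zero hδ h, zero_mul, zero_mul]
        · rw [indicator_of_notMem hzK, hFK δ hδ z hz hzK, norm_zero]
    _ ≤ ∫ z, K.indicator (fun z => deriv (layerCutoff δ) (l z) * (ε / (M + 1))) z :=
        setIntegral_le_integral hi (Eventually.of_forall fun z => indicator_nonneg (fun z _ => hnn z) z)
    _ = (∫ z in K, deriv (layerCutoff δ) (l z)) * (ε / (M + 1)) := by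
        rw [integral_indicator hK.measurableSet, integral_mul_const]
    _ ≤ M * (ε / (M + 1)) := by
        gcongr
        exact hM δ hδ
    _ < ε := by
        rw [mul_div_assoc', div_lt_iff₀ (by positivity)]
        nlinarith

end BoundaryLayer

/-! ### Maxwell's equations as a symmetric system -/

section MaxwellSystem

open scoped Matrix

/-- The electromagnetic field `(E, B)` at a point, with the Euclidean norm of `ℝ⁶`. -/
abbrev EMField : Type := WithLp 2 (R3 × R3)

/-- `x ↦ eⱼ × x`, the coefficient of `∂_{x_j}` in the curl. -/
noncomputable def axisCross (j : Fin 3) : R3 →L[ℝ] R3 :=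
  LinearMap.toContinuousLinearMap <|
    (WithLp.linearEquiv 2 ℝ (Fin 3 → ℝ)).symm.toLinearMap ∘ₗ crossProduct (Pi.single j 1) ∘ₗ
      (WithLp.linearEquiv 2 ℝ (Fin 3 → ℝ)).toLinearMap

theorem axisCross_apply (j : Fin 3) (x : R3) :
    axisCross j x = WithLp.toLp 2 (Pi.single j 1 ⨯₃ x.ofLp) := rfl

theorem sum_axisCross (D : Fin 3 → SpaceTime → R3) (z : SpaceTime) :
    ∑ j, axisCross j (D j z) = curlOf D z := by
  ext i
  fin_cases i <;> simp [Fin.sum_univ_three, axisCross_apply, curlOf, cross_apply, Pi.single_apply]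
    <;> ring

theorem inner_axisCross_left (j : Fin 3) (x y : R3) :
    inner ℝ (axisCross j x) y = - inner ℝ x (axisCross j y) := by
  fin_cases j <;>
    simp [axisCross_apply, cross_apply, PiLp.inner_apply, Fin.sum_univ_three]

theorem norm_axisCross_le (j : Fin 3) (x : R3) : ‖axisCross j x‖ ≤ ‖x‖ := by
  refine le_of_sq_le_sq ?_ (norm_nonneg x)
  rw [EuclideanSpace.norm_sq_eq, EuclideanSpace.norm_sq_eq]
  fin_cases j <;>
    simp [axisCross_apply, cross_apply, Fin.sum_univ_three] <;>
    nlinarith [sq_nonneg (x 0), sq_nonneg (x 1), sq_nonneg (x 2)]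

/-- The symmetric matrices of Maxwell's equations, written as the first order system
`∂ₜu + ∑ⱼ Aⱼ ∂ⱼu = 0` for `u = (E, B)`. The index `none` is the time direction. -/
noncomputable def maxwellSymbol : Option (Fin 3) → EMField →L[ℝ] EMField
  | none => ContinuousLinearMap.id ℝ EMField
  | some j =>
    ((WithLp.prodContinuousLinearEquiv 2 ℝ R3 R3).symm : R3 × R3 →L[ℝ] EMField) ∘L
      ((-(axisCross j ∘L ContinuousLinearMap.snd ℝ R3 R3)).prod
        (axisCross j ∘L ContinuousLinearMap.fst ℝ R3 R3)) ∘L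
      (WithLp.prodContinuousLinearEquiv 2 ℝ R3 R3 : EMField →L[ℝ] R3 × R3)

/-- The coordinate directions of space-time; `none` is the time direction. -/
noncomputable def coordDir : Option (Fin 3) → SpaceTime
  | none => timeDir
  | some j => spaceDir j

theorem maxwellSymbol_none (u : EMField) : maxwellSymbol none u = u := rfl

theorem maxwellSymbol_some_fst (j : Fin 3) (u : EMField) :
    (maxwellSymbol (some j) u).fst = - axisCross j u.snd := rfl

theorem maxwellSymbol_some_snd (j : Fin 3) (u : EMField) :
    (maxwellSymbol (some j) u).snd = axisCross j u.fst := rfl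

theorem EMField.inner_eq (u v : EMField) :
    inner ℝ u v = inner ℝ u.fst v.fst + inner ℝ u.snd v.snd := WithLp.prod_inner_apply u v

theorem inner_maxwellSymbol_left (a : Option (Fin 3)) (u v : EMField) :
    inner ℝ (maxwellSymbol a u) v = inner ℝ u (maxwellSymbol a v) := by
  cases a with
  | none => rfl
  | some j =>
    simp only [EMField.inner_eq, maxwellSymbol_some_fst, maxwellSymbol_some_snd, inner_neg_left,
      inner_neg_right, inner_axisCross_left]
    ring

/-- The flux of energy in the direction `eⱼ` is twice the `j`-th component of `E × B`. -/
theorem inner_maxwellSymbol_some (j : Fin 3) (u : EMField) :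
    inner ℝ u (maxwellSymbol (some j) u) = 2 * inner ℝ u.snd (axisCross j u.fst) := by
  have h : inner ℝ u.fst (axisCross j u.snd) = - inner ℝ u.snd (axisCross j u.fst) := by
    rw [real_inner_comm, inner_axisCross_left]
  simp only [EMField.inner_eq, maxwellSymbol_some_fst, maxwellSymbol_some_snd, inner_neg_right, h]
  ring

theorem abs_inner_maxwellSymbol_some_le (j : Fin 3) (u : EMField) :
    |inner ℝ u (maxwellSymbol (some j) u)| ≤ ‖u‖ ^ 2 := by
  rw [inner_maxwellSymbol_some, WithLp.prod_norm_sq_eq_of_L2, abs_mul, abs_two]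
  have h1 : |inner ℝ u.snd (axisCross j u.fst)| ≤ ‖u.snd‖ * ‖u.fst‖ :=
    (abs_real_inner_le_norm _ _).trans (by gcongr; exact norm_axisCross_le _ _)
  nlinarith [sq_nonneg (‖u.snd‖ - ‖u.fst‖)]

/-- The normal flux of energy vanishes where the tangential components of `E` do. -/
theorem inner_maxwellSymbol_two_eq_zero {u : EMField} (h0 : u.fst 0 = 0) (h1 : u.fst 1 = 0) :
    inner ℝ u (maxwellSymbol (some 2) u) = 0 := by
  have : axisCross 2 u.fst = 0 := by
    ext i
    fin_cases i <;> simp [axisCross_apply, cross_apply, h0, h1]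
  rw [inner_maxwellSymbol_some, this, inner_zero_right, mul_zero]

end MaxwellSystem

/-! ### A weight that decreases along the flow of energy -/

section ConeWeight

/-- `expNegInvGlue` has zero derivative where it vanishes. -/
theorem deriv_expNegInvGlue_of_nonpos {s : ℝ} (hs : s ≤ 0) : deriv expNegInvGlue s = 0 := by
  refine IsLocalMin.deriv_eq_zero (Filter.Eventually.of_forall fun r => ?_)
  rw [expNegInvGlue.zero_of_nonpos hs]
  exact expNegInvGlue.nonneg r

theorem deriv_expNegInvGlue_nonneg (s : ℝ) : 0 ≤ deriv expNegInvGlue s :=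
  expNegInvGlue.monotone.deriv_nonneg

theorem hasDerivAt_expNegInvGlue (s : ℝ) :
    HasDerivAt expNegInvGlue (deriv expNegInvGlue s) s :=
  ((expNegInvGlue.contDiff (n := 1)).differentiable (by simp) s).hasDerivAt

/-- A smooth function that vanishes for `s ≤ 0` and is strictly increasing for `s ≥ 0`. -/
noncomputable def timeProfile (s : ℝ) : ℝ := s * expNegInvGlue s

theorem timeProfile_nonneg (s : ℝ) : 0 ≤ timeProfile s := by
  rcases le_or_gt s 0 with h | h
  · simp [timeProfile, expNegInvGlue.zero_of_nonpos h]
  · exact mul_nonneg h.le (expNegInvGlue.nonneg s)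

theorem timeProfile_of_nonpos {s : ℝ} (hs : s ≤ 0) : timeProfile s = 0 := by
  simp [timeProfile, expNegInvGlue.zero_of_nonpos hs]

theorem contDiff_timeProfile : ContDiff ℝ 1 timeProfile :=
  contDiff_id.mul (expNegInvGlue.contDiff (n := 1))

theorem hasDerivAt_timeProfile (s : ℝ) : HasDerivAt timeProfile (deriv timeProfile s) s :=
  (contDiff_timeProfile.differentiable (by simp) s).hasDerivAt

theorem expNegInvGlue_le_deriv_timeProfile (s : ℝ) : expNegInvGlue s ≤ deriv timeProfile s := by
  have h : HasDerivAt timeProfile (1 * expNegInvGlue s + s * deriv expNegInvGlue s) s :=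
    (hasDerivAt_id s).mul (hasDerivAt_expNegInvGlue s)
  rw [h.deriv, one_mul, le_add_iff_nonneg_right]
  rcases le_or_gt s 0 with hs | hs
  · rw [deriv_expNegInvGlue_of_nonpos hs, mul_zero]
  · exact mul_nonneg hs.le (deriv_expNegInvGlue_nonneg s)

/-- `|x|² < R² - 6 R t` is a region that shrinks faster than the speed of propagation `1`. This is
the function whose positivity set it is. -/
noncomputable def coneFun (R : ℝ) (z : SpaceTime) : ℝ := R ^ 2 - 6 * R * z.1 - ‖z.2‖ ^ 2

/-- A `C¹` weight that lives on `{coneFun R > 0, t < S}` and decreases along the flow of energy. -/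
noncomputable def coneWeight (R S : ℝ) (z : SpaceTime) : ℝ :=
  expNegInvGlue (coneFun R z) * timeProfile (S - z.1)

variable {R S : ℝ}

theorem contDiff_coneFun : ContDiff ℝ 1 (coneFun R) :=
  (contDiff_const.sub (contDiff_const.mul contDiff_fst)).sub (contDiff_snd.norm_sq ℝ)

theorem contDiff_coneWeight : ContDiff ℝ 1 (coneWeight R S) :=
  ((expNegInvGlue.contDiff (n := 1)).comp contDiff_coneFun).mul
    (contDiff_timeProfile.comp (contDiff_const.sub contDiff_fst))

theorem fderiv_coneFun (z v : SpaceTime) :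
    fderiv ℝ (coneFun R) z v = - (6 * R * v.1) - 2 * inner ℝ z.2 v.2 := by
  have h1 : HasFDerivAt (fun z : SpaceTime => z.1) (ContinuousLinearMap.fst ℝ ℝ R3) z :=
    hasFDerivAt_fst
  have h2 : HasFDerivAt (fun z : SpaceTime => z.2) (ContinuousLinearMap.snd ℝ ℝ R3) z :=
    hasFDerivAt_snd
  have h := ((h1.const_mul (6 * R)).const_sub (R ^ 2)).sub h2.norm_sq
  rw [show coneFun R = fun z : SpaceTime => R ^ 2 - 6 * R * z.1 - ‖z.2‖ ^ 2 from rfl]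
  have h' := h.fderiv
  rw [show (fun z : SpaceTime => R ^ 2 - 6 * R * z.1 - ‖z.2‖ ^ 2)
    = ((fun z : SpaceTime => R ^ 2 - 6 * R * z.1) - fun z : SpaceTime => ‖z.2‖ ^ 2) from rfl, h']
  simp

theorem fderiv_coneWeight (z v : SpaceTime) :
    fderiv ℝ (coneWeight R S) z v
      = deriv expNegInvGlue (coneFun R z) * fderiv ℝ (coneFun R) z v * timeProfile (S - z.1)
        - expNegInvGlue (coneFun R z) * (deriv timeProfile (S - z.1) * v.1) := by
  have h1 : HasFDerivAt (fun z : SpaceTime => S - z.1) (-(ContinuousLinearMap.fst ℝ ℝ R3)) z :=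
    hasFDerivAt_fst.const_sub S
  have h2 := (hasDerivAt_timeProfile (S - z.1)).comp_hasFDerivAt z h1
  have h3 := (hasDerivAt_expNegInvGlue (coneFun R z)).comp_hasFDerivAt z
    (contDiff_coneFun.differentiable one_ne_zero z).hasFDerivAt
  have h := h3.mul h2
  rw [show coneWeight R S = (expNegInvGlue ∘ coneFun R) * (timeProfile ∘ fun z => S - z.1) from rfl,
    h.fderiv]
  simp
  ring

/-- The dissipation density: minus the derivative of the weight along the flow of energy. -/
noncomputable def dissipation (R S : ℝ) (u : SpaceTime → EMField) (z : SpaceTime) : ℝ :=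
  - ∑ a, fderiv ℝ (coneWeight R S) z (coordDir a) * inner ℝ (u z) (maxwellSymbol a (u z))

theorem coneFun_neg {z : SpaceTime} (hR : 0 ≤ R) (ht : 0 ≤ z.1) (hz : R < ‖z.2‖) :
    coneFun R z < 0 := by
  have : R ^ 2 < ‖z.2‖ ^ 2 := by gcongr
  have : 0 ≤ 6 * R * z.1 := by positivity
  unfold coneFun
  linarith

theorem fderiv_coneWeight_eq_zero {z : SpaceTime} (hz : coneFun R z ≤ 0) (v : SpaceTime) :
    fderiv ℝ (coneWeight R S) z v = 0 := by
  rw [fderiv_coneWeight, deriv_expNegInvGlue_of_nonpos hz, expNegInvGlue.zero_of_nonpos hz]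
  simp

/-- The weight decreases fast enough to absorb the flux: the dissipation is bounded below by the
energy density, weighted by a function that is positive inside the cone
for `t < S`. -/
theorem le_dissipation (hR : 0 ≤ R) (u : SpaceTime → EMField) {z : SpaceTime} (ht : 0 ≤ z.1) :
    expNegInvGlue (coneFun R z) * expNegInvGlue (S - z.1) * ‖u z‖ ^ 2 ≤ dissipation R S u z := by
  have hq : ∀ j : Fin 3, |inner ℝ (u z) (maxwellSymbol (some j) (u z))| ≤ ‖u z‖ ^ 2 :=
    fun j => abs_inner_maxwellSymbol_some_le j (u z)
  have hx : ∀ j : Fin 3, fderiv ℝ (coneFun R) z (spaceDir j) = - (2 * z.2 j) := fun j => by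
    simp [fderiv_coneFun, spaceDir, EuclideanSpace.inner_single_right]
  have htd : fderiv ℝ (coneFun R) z timeDir = - (6 * R) := by
    simp [fderiv_coneFun, timeDir]
  have hdis : dissipation R S u z
      = deriv expNegInvGlue (coneFun R z) * timeProfile (S - z.1)
          * (6 * R * ‖u z‖ ^ 2
            + ∑ j, 2 * (z.2 j * inner ℝ (u z) (maxwellSymbol (some j) (u z))))
        + expNegInvGlue (coneFun R z) * deriv timeProfile (S - z.1) * ‖u z‖ ^ 2 := by
    simp only [dissipation, Fintype.sum_option, coordDir, maxwellSymbol_none, fderiv_coneWeight,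
      htd, hx, real_inner_self_eq_norm_sq]
    simp only [timeDir, spaceDir, Fin.sum_univ_three]
    ring
  -- Each of the three space directions contributes a flux of at most `2 R ‖u‖²`, which is where the
  -- constant `6 R` in `coneFun` comes from.
  have hflux : 0 ≤ deriv expNegInvGlue (coneFun R z) * timeProfile (S - z.1)
      * (6 * R * ‖u z‖ ^ 2
        + ∑ j, 2 * (z.2 j * inner ℝ (u z) (maxwellSymbol (some j) (u z)))) := by
    rcases le_or_gt (coneFun R z) 0 with hc | hc
    · rw [deriv_expNegInvGlue_of_nonpos hc, zero_mul, zero_mul]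
    · refine mul_nonneg (mul_nonneg (deriv_expNegInvGlue_nonneg _) (timeProfile_nonneg _)) ?_
      have hxR : ‖z.2‖ ≤ R := by
        by_contra! h
        exact (coneFun_neg hR ht h).not_gt hc
      have hj : ∀ j : Fin 3,
          - (R * ‖u z‖ ^ 2) ≤ z.2 j * inner ℝ (u z) (maxwellSymbol (some j) (u z)) := fun j => by
        refine neg_le_of_abs_le ?_
        rw [abs_mul]
        refine mul_le_mul ?_ (hq j) (abs_nonneg _) hR
        exact (PiLp.norm_apply_le z.2 j).trans hxR
      rw [Fin.sum_univ_three]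
      linarith [hj 0, hj 1, hj 2]
  rw [hdis]
  refine le_add_of_nonneg_of_le hflux ?_
  gcongr
  · exact expNegInvGlue.nonneg _
  · exact expNegInvGlue_le_deriv_timeProfile _

end ConeWeight

/-! ### Uniqueness for the homogeneous system -/

section Uniqueness

open Filter
open scoped Topology

instance SpaceTime.isAddHaarMeasure_volume : (volume : Measure SpaceTime).IsAddHaarMeasure :=
  inferInstanceAs ((volume : Measure ℝ).prod (volume : Measure R3)).IsAddHaarMeasure

theorem isOpen_halfSpace : IsOpen halfSpace :=
  isOpen_lt continuous_const (EuclideanSpace.proj (2 : Fin 3)).continuous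

theorem isClosed_closedHalfSpace : IsClosed closedHalfSpace :=
  isClosed_le continuous_const (EuclideanSpace.proj (2 : Fin 3)).continuous

theorem halfSpace_subset_closedHalfSpace : halfSpace ⊆ closedHalfSpace :=
  fun x (hx : 0 < x 2) => show 0 ≤ x 2 from hx.le

theorem isOpen_cyl (T : ℝ) : IsOpen (cyl T) := isOpen_Ioo.prod isOpen_halfSpace

theorem cyl_subset (T : ℝ) : cyl T ⊆ Icc 0 T ×ˢ closedHalfSpace :=
  prod_mono Ioo_subset_Icc_self halfSpace_subset_closedHalfSpace

theorem closedHalfSpace_subset_closure : closedHalfSpace ⊆ closure halfSpace := by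
  intro x hx
  have hlim : Tendsto (fun s : ℝ => x + s • EuclideanSpace.single (2 : Fin 3) (1 : ℝ)) (𝓝[>] 0)
      (𝓝 x) := by
    have : Continuous fun s : ℝ => x + s • EuclideanSpace.single (2 : Fin 3) (1 : ℝ) := by fun_prop
    simpa using (this.tendsto 0).mono_left nhdsWithin_le_nhds
  refine mem_closure_of_tendsto hlim ?_
  filter_upwards [self_mem_nhdsWithin] with s hs
  have h1 : 0 ≤ x 2 := hx
  have h2 : 0 < s := hs
  have h3 : 0 < x 2 + s := by linarith
  simpa [halfSpace] using h3

/-- The part of `[0, T] × closure Ω` that the weight sees. -/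
def coneBox (T R : ℝ) : Set SpaceTime :=
  Icc 0 T ×ˢ (Metric.closedBall 0 R ∩ closedHalfSpace)

theorem isCompact_coneBox (T R : ℝ) : IsCompact (coneBox T R) :=
  isCompact_Icc.prod ((isCompact_closedBall 0 R).inter_right isClosed_closedHalfSpace)

theorem coneBox_subset (T R : ℝ) : coneBox T R ⊆ Icc 0 T ×ˢ closedHalfSpace :=
  prod_mono_right inter_subset_right

theorem coneFun_neg_of_notMem_coneBox {T R : ℝ} (hR : 0 ≤ R) {z : SpaceTime} (hz : z ∈ cyl T)
    (hzK : z ∉ coneBox T R) : coneFun R z < 0 := by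
  refine coneFun_neg hR hz.1.1.le ?_
  by_contra! h
  exact hzK ⟨Ioo_subset_Icc_self hz.1, by simpa using h, halfSpace_subset_closedHalfSpace hz.2⟩

/-- The coordinate function `x₃`, the distance to the boundary of the half space. -/
noncomputable def heightCLM : SpaceTime →L[ℝ] ℝ :=
  (EuclideanSpace.proj (2 : Fin 3)) ∘L (ContinuousLinearMap.snd ℝ ℝ R3)

theorem heightCLM_apply (z : SpaceTime) : heightCLM z = z.2 2 := rfl

/-- The cone weight, cut off near the initial time and near the boundary. -/
noncomputable def cutWeight (R S δ : ℝ) (z : SpaceTime) : ℝ :=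
  layerCutoff δ z.1 * layerCutoff δ (z.2 2) * coneWeight R S z

variable {T R S δ : ℝ}

theorem contDiff_cutWeight : ContDiff ℝ 1 (cutWeight R S δ) :=
  ((((layerCutoff.contDiff δ).of_le (by simp)).comp contDiff_fst).mul
    (((layerCutoff.contDiff δ).of_le (by simp)).comp heightCLM.contDiff)).mul contDiff_coneWeight

theorem fderiv_cutWeight (z v : SpaceTime) :
    fderiv ℝ (cutWeight R S δ) z v
      = deriv (layerCutoff δ) z.1 * v.1 * layerCutoff δ (z.2 2) * coneWeight R S z
        + layerCutoff δ z.1 * (deriv (layerCutoff δ) (z.2 2) * v.2 2) * coneWeight R S z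
        + layerCutoff δ z.1 * layerCutoff δ (z.2 2) * fderiv ℝ (coneWeight R S) z v := by
  have h1 := (layerCutoff.hasDerivAt δ z.1).comp_hasFDerivAt z
    (hasFDerivAt_fst : HasFDerivAt (fun z : SpaceTime => z.1) (ContinuousLinearMap.fst ℝ ℝ R3) z)
  have h2 := (layerCutoff.hasDerivAt δ (heightCLM z)).comp_hasFDerivAt z heightCLM.hasFDerivAt
  have h3 := ((contDiff_coneWeight (R := R) (S := S)).differentiable one_ne_zero z).hasFDerivAt
  have h := (h1.mul h2).mul h3
  rw [show cutWeight R S δ = (layerCutoff δ ∘ fun z : SpaceTime => z.1)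
    * (layerCutoff δ ∘ heightCLM) * coneWeight R S from rfl, h.fderiv]
  simp [heightCLM_apply]
  ring

theorem support_cutWeight_subset (hR : 0 ≤ R) (hδ : 0 < δ) :
    Function.support (cutWeight R S δ)
      ⊆ Icc δ S ×ˢ (Metric.closedBall 0 R ∩ {x : R3 | δ ≤ x 2}) := by
  intro z hz
  have hz' : layerCutoff δ z.1 * layerCutoff δ (z.2 2) * coneWeight R S z ≠ 0 := hz
  have h1 : δ < z.1 := layerCutoff.lt_of_ne_zero hδ (left_ne_zero_of_mul (left_ne_zero_of_mul hz'))
  have h2 : δ < z.2 2 :=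
    layerCutoff.lt_of_ne_zero hδ (right_ne_zero_of_mul (left_ne_zero_of_mul hz'))
  have h3 := right_ne_zero_of_mul hz'
  refine ⟨⟨h1.le, ?_⟩, ?_, h2.le⟩
  · by_contra! h
    exact right_ne_zero_of_mul h3 (timeProfile_of_nonpos (by linarith))
  · rw [mem_closedBall_zero_iff]
    by_contra! h
    exact left_ne_zero_of_mul h3
      (expNegInvGlue.zero_of_nonpos (coneFun_neg hR (hδ.trans h1).le h).le)

theorem isCompact_cutBox : IsCompact (Icc δ S ×ˢ (Metric.closedBall 0 R ∩ {x : R3 | δ ≤ x 2})) :=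
  isCompact_Icc.prod ((isCompact_closedBall 0 R).inter_right
    (isClosed_le continuous_const (EuclideanSpace.proj (2 : Fin 3)).continuous))

theorem hasCompactSupport_cutWeight (hR : 0 ≤ R) (hδ : 0 < δ) :
    HasCompactSupport (cutWeight R S δ) :=
  HasCompactSupport.of_support_subset_isCompact isCompact_cutBox (support_cutWeight_subset hR hδ)

theorem tsupport_cutWeight_subset (hR : 0 ≤ R) (hδ : 0 < δ) (hS : S < T) :
    tsupport (cutWeight R S δ) ⊆ cyl T := by
  refine (closure_minimal (support_cutWeight_subset hR hδ) isCompact_cutBox.isClosed).trans ?_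
  rintro z ⟨h1, -, h2⟩
  exact ⟨⟨hδ.trans_le h1.1, h1.2.trans_lt hS⟩, hδ.trans_le h2⟩

/-- A continuous function on a compact set `K` that vanishes on `U \ K` is integrable on `U`. -/
theorem ContinuousOn.integrableOn_of_forall_notMem {X : Type*} [TopologicalSpace X] [T2Space X]
    [MeasurableSpace X] [OpensMeasurableSpace X] {μ : Measure X} [IsFiniteMeasureOnCompacts μ]
    {K U : Set X} {f : X → ℝ} (hf : ContinuousOn f K) (hK : IsCompact K) (hU : MeasurableSet U)
    (h0 : ∀ z ∈ U, z ∉ K → f z = 0) : IntegrableOn f U μ :=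
  (hf.integrableOn_compact hK).of_forall_sdiff_eq_zero hU fun z hz => h0 z hz.1 hz.2

/-- Uniqueness for the homogeneous Maxwell system: a bounded continuous weak solution with zero
initial values whose normal flux of energy vanishes on `∂Ω` is zero. -/
theorem eq_zero_of_maxwellSymbol_system {u : SpaceTime → EMField}
    {du : Option (Fin 3) → SpaceTime → EMField}
    (hcont : ContinuousOn u (Icc 0 T ×ˢ closedHalfSpace)) {M : ℝ} (hM : ∀ z ∈ cyl T, ‖u z‖ ≤ M)
    (hw : ∀ a, IsWeakDeriv (cyl T) (coordDir a) u (du a))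
    (hsum : ∀ᵐ z ∂(volume.restrict (cyl T)), ∑ a, maxwellSymbol a (du a z) = 0)
    (hinit : ∀ x ∈ closedHalfSpace, u (0, x) = 0)
    (hbdry : ∀ t ∈ Icc 0 T, ∀ x : R3, x 2 = 0 →
      inner ℝ (u (t, x)) (maxwellSymbol (some 2) (u (t, x))) = 0) {z₀ : SpaceTime}
    (hz₀ : z₀ ∈ cyl T) : u z₀ = 0 := by
  have hz₀t : z₀.1 ∈ Ioo 0 T := hz₀.1
  -- The backward cone `|x|² < R² - 6 R t` contains `z₀`, and `S` lies between `z₀.1` and `T`.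
  obtain ⟨S, hS₀, hS⟩ := exists_between hz₀t.2
  set R : ℝ := 6 * T + ‖z₀.2‖ + 1 with hRdef
  have hT : 0 < T := hz₀t.1.trans hz₀t.2
  have hR : 0 ≤ R := by positivity
  have hcone : 0 < coneFun R z₀ := by
    have h1 : 6 * R * z₀.1 ≤ 6 * R * T := by gcongr; exact hz₀t.2.le
    unfold coneFun
    nlinarith [norm_nonneg z₀.2]
  have hUo := isOpen_cyl T
  have hUm := hUo.measurableSet
  have hK := isCompact_coneBox T R
  set q : Option (Fin 3) → SpaceTime → ℝ := fun a z => inner ℝ (u z) (maxwellSymbol a (u z)) with hq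
  have hqc : ∀ a, ContinuousOn (q a) (Icc 0 T ×ˢ closedHalfSpace) := fun a =>
    hcont.inner ((maxwellSymbol a).continuous.comp_continuousOn hcont)
  have hqK : ∀ a, ContinuousOn (q a) (coneBox T R) := fun a => (hqc a).mono (coneBox_subset T R)
  have hwc : Continuous (coneWeight R S) := contDiff_coneWeight.continuous
  have hw0 : ∀ z ∈ cyl T, z ∉ coneBox T R → coneWeight R S z = 0 := fun z hz hzK => by
    rw [coneWeight, expNegInvGlue.zero_of_nonpos (coneFun_neg_of_notMem_coneBox hR hz hzK).le,
      zero_mul]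
  have hPc : ContinuousOn (dissipation R S u) (Icc 0 T ×ˢ closedHalfSpace) :=
    (continuousOn_finsetSum _ fun a _ => (((contDiff_coneWeight.continuous_fderiv
      one_ne_zero).clm_apply continuous_const).continuousOn).mul (hqc a)).neg
  have hPi : IntegrableOn (dissipation R S u) (cyl T) volume := by
    refine (hPc.mono (coneBox_subset T R)).integrableOn_of_forall_notMem hK hUm fun z hz hzK => ?_
    simp [dissipation,
      fderiv_coneWeight_eq_zero (coneFun_neg_of_notMem_coneBox hR hz hzK).le]
  have hP0 : ∀ z ∈ cyl T, 0 ≤ dissipation R S u z := fun z hz =>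
    le_trans (mul_nonneg (mul_nonneg (expNegInvGlue.nonneg _) (expNegInvGlue.nonneg _))
      (sq_nonneg _)) (le_dissipation hR u hz.1.1.le)
  let F₀ : ℝ → SpaceTime → ℝ := fun δ z =>
    deriv (layerCutoff δ) z.1 * layerCutoff δ (z.2 2) * (coneWeight R S z * q none z)
  let F₂ : ℝ → SpaceTime → ℝ := fun δ z =>
    deriv (layerCutoff δ) (z.2 2) * layerCutoff δ z.1 * (coneWeight R S z * q (some 2) z)
  let P : ℝ → SpaceTime → ℝ := fun δ z =>
    layerCutoff δ z.1 * layerCutoff δ (z.2 2) * dissipation R S u z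
  have hc1 : ∀ δ, Continuous fun z : SpaceTime => layerCutoff δ z.1 := fun δ =>
    (layerCutoff.contDiff δ).continuous.comp continuous_fst
  have hc2 : ∀ δ, Continuous fun z : SpaceTime => layerCutoff δ (z.2 2) := fun δ =>
    (layerCutoff.contDiff δ).continuous.comp heightCLM.continuous
  have hc3 : ∀ δ, Continuous fun z : SpaceTime => deriv (layerCutoff δ) z.1 := fun δ =>
    (layerCutoff.continuous_deriv δ).comp continuous_fst
  have hc4 : ∀ δ, Continuous fun z : SpaceTime => deriv (layerCutoff δ) (z.2 2) := fun δ =>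
    (layerCutoff.continuous_deriv δ).comp heightCLM.continuous
  have hF₀K : ∀ δ, ∀ z ∈ cyl T, z ∉ coneBox T R → F₀ δ z = 0 := fun δ z hz hzK => by
    simp [F₀, hw0 z hz hzK]
  have hF₂K : ∀ δ, ∀ z ∈ cyl T, z ∉ coneBox T R → F₂ δ z = 0 := fun δ z hz hzK => by
    simp [F₂, hw0 z hz hzK]
  have hF₀i : ∀ δ, IntegrableOn (F₀ δ) (cyl T) volume := fun δ =>
    ((((hc3 δ).mul (hc2 δ)).continuousOn).mul
      (hwc.continuousOn.mul (hqK none))).integrableOn_of_forall_notMem hK hUm (hF₀K δ)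
  have hF₂i : ∀ δ, IntegrableOn (F₂ δ) (cyl T) volume := fun δ =>
    ((((hc4 δ).mul (hc1 δ)).continuousOn).mul
      (hwc.continuousOn.mul (hqK (some 2)))).integrableOn_of_forall_notMem hK hUm (hF₂K δ)
  have hPm : ∀ δ z, ‖P δ z‖ ≤ ‖dissipation R S u z‖ := fun δ z => by
    simp only [P, norm_mul, Real.norm_eq_abs]
    refine mul_le_of_le_one_left (abs_nonneg _) ?_
    exact mul_le_one₀ (layerCutoff.abs_le_one _ _) (abs_nonneg _) (layerCutoff.abs_le_one _ _)
  have hPδi : ∀ δ, IntegrableOn (P δ) (cyl T) volume := fun δ =>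
    Integrable.mono hPi ((((hc1 δ).mul (hc2 δ)).continuousOn.mul
      (hPc.mono (cyl_subset T))).aestronglyMeasurable hUm) (Eventually.of_forall (hPm δ))
  -- The energy identity for the cut off weight: `F₀` and `F₂` collect the terms in which a cutoff is
  -- differentiated; the other terms make up `P`.
  have hident : ∀ δ > 0, ∫ z in cyl T, P δ z = (∫ z in cyl T, F₀ δ z) + ∫ z in cyl T, F₂ δ z := by
    intro δ hδ
    have h := integral_fderiv_mul_inner_eq_zero hUo inner_maxwellSymbol_left hw hsum
      (hcont.mono (cyl_subset T)) hM (contDiff_cutWeight (R := R) (S := S) (δ := δ))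
      (hasCompactSupport_cutWeight hR hδ) (tsupport_cutWeight_subset hR hδ hS)
    have hpt : ∀ z, ∑ a, fderiv ℝ (cutWeight R S δ) z (coordDir a) * q a z
        = F₀ δ z + F₂ δ z - P δ z := fun z => by
      simp only [P, F₀, F₂, dissipation, fderiv_cutWeight, Fintype.sum_option, Fin.sum_univ_three,
        coordDir, timeDir, spaceDir]
      simp [hq]
      ring
    simp only [hq] at hpt
    have hsplit : ∫ z in cyl T, (F₀ δ z + F₂ δ z - P δ z)
        = (∫ z in cyl T, F₀ δ z) + (∫ z in cyl T, F₂ δ z) - ∫ z in cyl T, P δ z := by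
      rw [← integral_add (hF₀i δ) (hF₂i δ)]
      exact integral_sub ((hF₀i δ).add (hF₂i δ)) (hPδi δ)
    rw [integral_congr_ae (Eventually.of_forall hpt), hsplit] at h
    linarith
  have hlim₀ : Tendsto (fun δ => ∫ z in cyl T, F₀ δ z) (𝓝[>] 0) (𝓝 0) := by
    refine tendsto_setIntegral_layer hUm hK (ContinuousLinearMap.fst ℝ ℝ R3) (d := timeDir) rfl
      (hwc.continuousOn.mul (hqK none)) (fun z hz => hz.1.1) (fun z hz h0 => ?_)
      (fun δ hδ z _ _ => ?_) (fun δ _ => hF₀K δ)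
    · have h1 : z = (0, z.2) := Prod.ext h0 rfl
      have h2 : u z = 0 := by
        rw [h1]
        exact hinit _ hz.2.2
      simp [hq, h2]
    · change |deriv (layerCutoff δ) (z.1) * layerCutoff δ (z.2 2) * (coneWeight R S z * q none z)|
        ≤ deriv (layerCutoff δ) (z.1) * |coneWeight R S z * q none z|
      rw [abs_mul, abs_mul, abs_of_nonneg (layerCutoff.deriv_nonneg hδ _)]
      exact mul_le_mul_of_nonneg_right (mul_le_of_le_one_right (layerCutoff.deriv_nonneg hδ _)
        (layerCutoff.abs_le_one _ _)) (abs_nonneg _)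
  have hlim₂ : Tendsto (fun δ => ∫ z in cyl T, F₂ δ z) (𝓝[>] 0) (𝓝 0) := by
    refine tendsto_setIntegral_layer hUm hK heightCLM (d := spaceDir 2)
      (by simp [heightCLM_apply, spaceDir])
      (hwc.continuousOn.mul (hqK (some 2))) (fun z hz => hz.2.2) (fun z hz h0 => ?_)
      (fun δ hδ z _ _ => ?_) (fun δ _ => hF₂K δ)
    · have h2 : q (some 2) z = 0 := hbdry z.1 hz.1 z.2 h0
      simp [h2]
    · change |deriv (layerCutoff δ) (z.2 2) * layerCutoff δ (z.1) * (coneWeight R S z * q (some 2) z)|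
        ≤ deriv (layerCutoff δ) (z.2 2) * |coneWeight R S z * q (some 2) z|
      rw [abs_mul, abs_mul, abs_of_nonneg (layerCutoff.deriv_nonneg hδ _)]
      exact mul_le_mul_of_nonneg_right (mul_le_of_le_one_right (layerCutoff.deriv_nonneg hδ _)
        (layerCutoff.abs_le_one _ _)) (abs_nonneg _)
  have hlimP : Tendsto (fun δ => ∫ z in cyl T, P δ z) (𝓝[>] 0)
      (𝓝 (∫ z in cyl T, dissipation R S u z)) := by
    refine tendsto_integral_filter_of_dominated_convergence _
      (Eventually.of_forall fun δ => (hPδi δ).aestronglyMeasurable)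
      (Eventually.of_forall fun δ => Eventually.of_forall (hPm δ)) hPi.norm ?_
    filter_upwards [ae_restrict_mem hUm] with z hz
    have := ((layerCutoff.tendsto_one hz.1.1).mul (layerCutoff.tendsto_one hz.2)).mul_const
      (dissipation R S u z)
    simpa only [mul_one, one_mul] using this
  have hint : ∫ z in cyl T, dissipation R S u z = 0 := by
    refine tendsto_nhds_unique hlimP ?_
    have := (hlim₀.add hlim₂)
    rw [add_zero] at this
    refine this.congr' ?_
    filter_upwards [self_mem_nhdsWithin] with δ hδ
    exact (hident δ hδ).symm
  have hPzero : dissipation R S u z₀ = 0 := by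
    have hae : dissipation R S u =ᵐ[volume.restrict (cyl T)] 0 := by
      refine (integral_eq_zero_iff_of_nonneg_ae ?_ hPi).1 hint
      filter_upwards [ae_restrict_mem hUm] with z hz using hP0 z hz
    exact Measure.eqOn_open_of_ae_eq hae hUo (hPc.mono (cyl_subset T)) continuousOn_const hz₀
  have hle := le_dissipation hR u (S := S) hz₀t.1.le
  rw [hPzero] at hle
  have hpos : 0 < expNegInvGlue (coneFun R z₀) * expNegInvGlue (S - z₀.1) :=
    mul_pos (expNegInvGlue.pos_of_pos hcone) (expNegInvGlue.pos_of_pos (sub_pos.2 hS₀))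
  have : ‖u z₀‖ ^ 2 ≤ 0 := nonpos_of_mul_nonpos_right hle hpos
  simpa using this

end Uniqueness

/-! ### Traces and the difference of two solutions -/

section Traces

variable {T : ℝ}

theorem MeasureTheory.MemLp.exists_ae_norm_le {α F : Type*} [MeasurableSpace α] {μ : Measure α}
    [NormedAddCommGroup F] {f : α → F} (hf : MemLp f (⊤ : ℝ≥0∞) μ) :
    ∃ M : ℝ, ∀ᵐ z ∂μ, ‖f z‖ ≤ M := by
  have htop : eLpNormEssSup f μ ≠ ⊤ := by
    rw [← eLpNorm_exponent_top]
    exact hf.eLpNorm_ne_top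
  refine ⟨(eLpNormEssSup f μ).toReal, ?_⟩
  filter_upwards [enorm_ae_le_eLpNormEssSup f μ] with z hz
  rw [← toReal_enorm]
  exact ENNReal.toReal_mono htop hz

/-- The continuous representative of a bounded field is bounded at every point. -/
theorem IsContRep.exists_norm_le {F F' : SpaceTime → R3} (h : IsContRep T F F')
    (hF : MemLp F (⊤ : ℝ≥0∞) (volume.restrict (cyl T))) : ∃ M : ℝ, ∀ z ∈ cyl T, ‖F' z‖ ≤ M := by
  obtain ⟨M, hM⟩ := hF.exists_ae_norm_le
  have hc : ContinuousOn F' (cyl T) := h.1.mono (cyl_subset T)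
  have hae : (fun z => max ‖F' z‖ M) =ᵐ[volume.restrict (cyl T)] fun _ => M := by
    filter_upwards [hM, h.2] with z hz hzz
    exact max_eq_right (hzz ▸ hz)
  have := Measure.eqOn_open_of_ae_eq hae (isOpen_cyl T) (hc.norm.sup continuousOn_const)
    continuousOn_const
  exact ⟨M, fun z hz => max_eq_right_iff.1 (this hz)⟩

/-- Initial traces that agree almost everywhere in `Ω` agree on the closed half space. -/
theorem eq_of_initial_trace_ae_eq (hT : 0 ≤ T) {F G : SpaceTime → R3} {F₀ : R3 → R3}
    (hF : ContinuousOn F (Icc 0 T ×ˢ closedHalfSpace))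
    (hG : ContinuousOn G (Icc 0 T ×ˢ closedHalfSpace))
    (hF₀ : ∀ᵐ x ∂(volume.restrict halfSpace), F (0, x) = F₀ x)
    (hG₀ : ∀ᵐ x ∂(volume.restrict halfSpace), G (0, x) = F₀ x) {x : R3}
    (hx : x ∈ closedHalfSpace) : F (0, x) = G (0, x) := by
  have hsec : ∀ {H : SpaceTime → R3}, ContinuousOn H (Icc 0 T ×ˢ closedHalfSpace) →
      ContinuousOn (fun x => H (0, x)) closedHalfSpace := fun hH =>
    hH.comp (by fun_prop) fun y hy => ⟨left_mem_Icc.2 hT, hy⟩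
  have hae : (fun x => F (0, x)) =ᵐ[volume.restrict halfSpace] fun x => G (0, x) := by
    filter_upwards [hF₀, hG₀] with y h1 h2 using h1.trans h2.symm
  have hopen := Measure.eqOn_open_of_ae_eq hae isOpen_halfSpace
    ((hsec hF).mono halfSpace_subset_closedHalfSpace)
    ((hsec hG).mono halfSpace_subset_closedHalfSpace)
  exact hopen.of_subset_closure (hsec hF) (hsec hG) halfSpace_subset_closedHalfSpace
    closedHalfSpace_subset_closure hx

/-- A component that vanishes on the boundary for `0 < t < T` does so for `0 ≤ t ≤ T`. -/
theorem boundary_trace_eq_zero_of_mem_Icc (hT : 0 < T) {F : SpaceTime → R3}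
    (hF : ContinuousOn F (Icc 0 T ×ˢ closedHalfSpace)) {x : R3} (hx : x ∈ closedHalfSpace)
    {i : Fin 3} (h : ∀ t ∈ Ioo 0 T, F (t, x) i = 0) {t : ℝ} (ht : t ∈ Icc 0 T) :
    F (t, x) i = 0 := by
  have hc : ContinuousOn (fun t => F (t, x) i) (Icc 0 T) :=
    (EuclideanSpace.proj (𝕜 := ℝ) i).continuous.comp_continuousOn
      (hF.comp (by fun_prop) fun s hs => ⟨hs, hx⟩)
  have : EqOn (fun t => F (t, x) i) (fun _ => 0) (Ioo 0 T) := h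
  exact this.of_subset_closure hc continuousOn_const Ioo_subset_Icc_self
    (closure_Ioo hT.ne).ge ht

/-- Weak derivatives of the pair of two fields. -/
theorem IsWeakDeriv.toLp_prodMk {U : Set SpaceTime} {v : SpaceTime} {e e' b b' : SpaceTime → R3}
    (he : IsWeakDeriv U v e e') (hb : IsWeakDeriv U v b b') :
    IsWeakDeriv U v (fun z => (WithLp.toLp 2 (e z, b z) : EMField))
      (fun z => (WithLp.toLp 2 (e' z, b' z) : EMField)) := by
  let P : R3 × R3 →L[ℝ] EMField := (WithLp.prodContinuousLinearEquiv 2 ℝ R3 R3).symm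
  have hP : ∀ x y : R3, P (x, 0) + P (0, y) = WithLp.toLp 2 (x, y) := fun x y => by
    rw [← map_add, Prod.mk_add_mk, add_zero, zero_add]
    rfl
  have h := (he.clm_comp (P ∘L ContinuousLinearMap.inl ℝ R3 R3)).add
    (hb.clm_comp (P ∘L ContinuousLinearMap.inr ℝ R3 R3))
  simpa only [ContinuousLinearMap.comp_apply, ContinuousLinearMap.inl_apply,
    ContinuousLinearMap.inr_apply, hP] using h

end Traces

theorem mainTheorem4 (T : ℝ) (hT : 0 < T) (p : ℝ≥0∞) (hp : 1 < p)
    (E₀ B₀ : R3 → R3) (hE₀ : MemW1 p halfSpace E₀) (hB₀ : MemW1 p halfSpace B₀)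
    (ρ : SpaceTime → ℝ) (J : SpaceTime → R3)
    (dρ : Fin 3 → SpaceTime → ℝ) (dJ : Fin 3 → SpaceTime → R3) (dtJ : SpaceTime → R3)
    (hdρ : ∀ i, IsWeakDeriv (cyl T) (spaceDir i) ρ (dρ i) ∧ MemLinftyLpLoc T p (dρ i))
    (hdJ : ∀ i, IsWeakDeriv (cyl T) (spaceDir i) J (dJ i) ∧ MemLinftyLpLoc T p (dJ i))
    (hdtJ : IsWeakDeriv (cyl T) timeDir J dtJ ∧ MemLinftyLpLoc T p dtJ)
    (hcont : IsWeakDeriv (cyl T) timeDir ρ (fun z => - divOf dJ z))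
    (E B E' B' : SpaceTime → R3)
    (hEB : IsMaxwellSolution T ρ J E₀ B₀ E B)
    (hEB' : IsMaxwellSolution T ρ J E₀ B₀ E' B') :
    E =ᵐ[volume.restrict (cyl T)] E' ∧ B =ᵐ[volume.restrict (cyl T)] B' := by
  obtain ⟨e, he, he0, hebd⟩ := hEB.traceE
  obtain ⟨e', he', he0', hebd'⟩ := hEB'.traceE
  obtain ⟨b, hb, hb0, -⟩ := hEB.traceB
  obtain ⟨b', hb', hb0', -⟩ := hEB'.traceB
  obtain ⟨dtE, dtB, dE, dB, htE, htB, hdE, hdB, heq⟩ := hEB.maxwell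
  obtain ⟨dtE', dtB', dE', dB', htE', htB', hdE', hdB', heq'⟩ := hEB'.maxwell
  obtain ⟨M₁, hM₁⟩ := he.exists_norm_le hEB.memE.1
  obtain ⟨M₂, hM₂⟩ := he'.exists_norm_le hEB'.memE.1
  obtain ⟨M₃, hM₃⟩ := hb.exists_norm_le hEB.memB.1
  obtain ⟨M₄, hM₄⟩ := hb'.exists_norm_le hEB'.memB.1
  let u : SpaceTime → EMField := fun z => WithLp.toLp 2 (e z - e' z, b z - b' z)
  let du : Option (Fin 3) → SpaceTime → EMField := fun a => match a with
    | none => fun z => WithLp.toLp 2 (dtE z - dtE' z, dtB z - dtB' z)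
    | some j => fun z => WithLp.toLp 2 (dE j z - dE' j z, dB j z - dB' j z)
  have huc : ContinuousOn u (Icc 0 T ×ˢ closedHalfSpace) :=
    (WithLp.prodContinuousLinearEquiv 2 ℝ R3 R3).symm.continuous.comp_continuousOn
      ((he.1.sub he'.1).prodMk (hb.1.sub hb'.1))
  have hM : ∀ z ∈ cyl T, ‖u z‖ ≤ (M₁ + M₂) + (M₃ + M₄) := fun z hz => by
    have h1 : ‖e z - e' z‖ ≤ M₁ + M₂ := (norm_sub_le _ _).trans (add_le_add (hM₁ z hz) (hM₂ z hz))
    have h2 : ‖b z - b' z‖ ≤ M₃ + M₄ := (norm_sub_le _ _).trans (add_le_add (hM₃ z hz) (hM₄ z hz))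
    refine le_trans ?_ (add_le_add h1 h2)
    refine le_of_sq_le_sq ?_ (by positivity)
    rw [WithLp.prod_norm_sq_eq_of_L2]
    change ‖e z - e' z‖ ^ 2 + ‖b z - b' z‖ ^ 2 ≤ _
    nlinarith [norm_nonneg (e z - e' z), norm_nonneg (b z - b' z)]
  have hw : ∀ a, IsWeakDeriv (cyl T) (coordDir a) u (du a) := fun a => by
    match a with
    | none =>
      exact ((htE.congr_left he.2).sub (htE'.congr_left he'.2)).toLp_prodMk
        ((htB.congr_left hb.2).sub (htB'.congr_left hb'.2))
    | some j =>
      exact (((hdE j).congr_left he.2).sub ((hdE' j).congr_left he'.2)).toLp_prodMk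
        (((hdB j).congr_left hb.2).sub ((hdB' j).congr_left hb'.2))
  -- The current density cancels in the difference of the two equations.
  have hsum : ∀ᵐ z ∂(volume.restrict (cyl T)), ∑ a, maxwellSymbol a (du a z) = 0 := by
    filter_upwards [heq, heq'] with z h h'
    obtain ⟨h1, h2, -, -⟩ := h
    obtain ⟨h1', h2', -, -⟩ := h'
    have hcurl : ∀ D D' : Fin 3 → SpaceTime → R3,
        ∑ j, axisCross j (D j z - D' j z) = curlOf D z - curlOf D' z := fun D D' => by
      simp only [map_sub, Finset.sum_sub_distrib, sum_axisCross]
    have hB := hcurl dB dB'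
    have hE := hcurl dE dE'
    rw [Fin.sum_univ_three] at hB hE
    rw [Fintype.sum_option, Fin.sum_univ_three]
    apply WithLp.ofLp_injective
    refine Prod.ext ?_ ?_
    · change (dtE z - dtE' z) + (- axisCross 0 (dB 0 z - dB' 0 z)
        + - axisCross 1 (dB 1 z - dB' 1 z) + - axisCross 2 (dB 2 z - dB' 2 z)) = 0
      rw [← neg_add, ← neg_add, hB, h1, h1']
      abel
    · change (dtB z - dtB' z) + (axisCross 0 (dE 0 z - dE' 0 z)
        + axisCross 1 (dE 1 z - dE' 1 z) + axisCross 2 (dE 2 z - dE' 2 z)) = 0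
      rw [hE, h2, h2']
      abel
  have hinit : ∀ x ∈ closedHalfSpace, u (0, x) = 0 := fun x hx => by
    have h1 := eq_of_initial_trace_ae_eq hT.le he.1 he'.1 he0 he0' hx
    have h2 := eq_of_initial_trace_ae_eq hT.le hb.1 hb'.1 hb0 hb0' hx
    simp [u, h1, h2]
  have hbdry : ∀ t ∈ Icc 0 T, ∀ x : R3, x 2 = 0 →
      inner ℝ (u (t, x)) (maxwellSymbol (some 2) (u (t, x))) = 0 := fun t ht x hx => by
    have hx' : x ∈ closedHalfSpace := hx.ge
    have htr : ∀ i : Fin 3, i = 0 ∨ i = 1 → (e (t, x) - e' (t, x)) i = 0 := fun i hi => by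
      have h1 : e (t, x) i = 0 := boundary_trace_eq_zero_of_mem_Icc hT he.1 hx' (fun s hs => by
        rcases hi with rfl | rfl
        exacts [(hebd s hs x hx).1, (hebd s hs x hx).2]) ht
      have h2 : e' (t, x) i = 0 := boundary_trace_eq_zero_of_mem_Icc hT he'.1 hx' (fun s hs => by
        rcases hi with rfl | rfl
        exacts [(hebd' s hs x hx).1, (hebd' s hs x hx).2]) ht
      simp [h1, h2]
    exact inner_maxwellSymbol_two_eq_zero (htr 0 (Or.inl rfl)) (htr 1 (Or.inr rfl))
  have hzero : ∀ z ∈ cyl T, e z = e' z ∧ b z = b' z := fun z hz => by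
    have h := eq_zero_of_maxwellSymbol_system huc hM hw hsum hinit hbdry hz
    exact ⟨sub_eq_zero.1 (congrArg WithLp.fst h), sub_eq_zero.1 (congrArg WithLp.snd h)⟩
  have hmem := ae_restrict_mem (μ := volume) (isOpen_cyl T).measurableSet
  constructor
  · filter_upwards [he.2, he'.2, hmem] with z h1 h2 hz
    rw [h1, h2, (hzero z hz).1]
  · filter_upwards [hb.2, hb'.2, hmem] with z h1 h2 hz
    rw [h1, h2, (hzero z hz).2]
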